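/- **Conventions.** All objects below are sequences (or families over an arbitrary index set, not displayed): dimensions $p,n\in\mathbb N$, integers $m\in\mathbb N$, reals $\sigma,\kappa>0$, probability spaces, and random matrices $X$. The exponent $q>0$ is fixed, and "constant" means independent of the index. On real matrices, $\|M\|_F=\sqrt{\operatorname{tr}(MM^T)}$, $\|M\|$ is the spectral norm, and $\|M\|_*=\operatorname{tr}\sqrt{MM^T}$ is the nuclear norm. Let $Z$ be a random vector of a normed space $(E,\|\cdot\|_E)$. * $Z\propto_c\mathcal E_q(\sigma)$ in $(E,\|\cdot\|_E)$ means: there are constants $C,c>0$ such that for every $1$-Lipschitz quasi-convex $f:E\to\mathbb R$ (all sublevel sets $\{f\le r\}$ convex), $f(Z)$ is integrable and $\mathbb P(|f(Z)-\mathbb E[f(Z)]|\ge t)\le Ce^{-(t/c\sigma)^q}$ for all $t>0$. * $Z\in\mathcal E_q(\sigma)$ in $(E,\|\cdot\|_E)$ means: there are a deterministic $\tilde Z\in E$ and constants $C,c>0$ such that for every linear form $f$ with $|f(x)|\le\|x\|_E$ for all $x$, $\mathbb P(|f(Z)-f(\tilde Z)|\ge t)\le Ce^{-(t/c\sigma)^q}$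 for all $t>0$. * Adding "$\,|\ e^{-\theta}$" to either property means: there is an event $\mathcal A$ with $\mathbb P(\mathcal A)>0$ and $\mathbb P(\mathcal A^c)\le Ce^{-\theta/c}$ for some constants $C,c>0$, such that $Z$ has the property under the conditional probability $\mathbb P(\,\cdot\mid\mathcal A)$. **Proposition.** (1) Let $X\in\mathcal M_p(\mathbb R)$ be a random matrix such that $X\propto_c\mathcal E_q(\sigma)$ in $(\mathcal M_p,\|\cdot\|_F)$ (or, more generally, $X\propto_c\mathcal E_q(\sigma)\ |\ e^{-p}$), and suppose that $\mathbb P(\|X\|\ge\kappa)\le Ce^{-cp}$ for some constants $C,c>0$. Then $$X^m\in\mathcal E_q\big(\sqrt p\,(2e\kappa)^{m-1}\sigma\big)\ \big|\ e^{-p}\quad\text{in }(\mathcal M_p,\|\cdot\|_*).$$ (2) Let $X\in\mathcal M_{p,n}(\mathbb R)$ be a random matrix such that $X\propto_c\mathcal E_q(\sigma)$ in $(\mathcal M_{p,n},\|\cdot\|_F)$ (or, more generally, $X\propto_c\mathcal E_q(\sigma)\ |\ e^{-(p+n)}$). Suppose that $\mathbb P(\|X\|\ge\kappa)\le Ce^{-c(p+n)}$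 for some constants $C,c>0$, that $X$ is integrable, and that $\|\mathbb E[X]\|\le K(p+n)^{1/q}$ for some constant $K$. Then $$(XX^T)^m\in\mathcal E_q\big(\sqrt{p+n}\,(2e\kappa)^{2m-1}\sigma\big)\ \big|\ e^{-(p+n)}\quad\text{in }(\mathcal M_p,\|\cdot\|_*),$$ $$(XX^T)^mX\in\mathcal E_q\big(\sqrt{p+n}\,(2e\kappa)^{2m}\sigma\big)\ \big|\ e^{-(p+n)}\quad\text{in }(\mathcal M_{p,n},\|\cdot\|_*).$$ -/

import Mathlib

open MeasureTheory ProbabilityTheory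

noncomputable section

namespace MatrixConcentration

/-- The Frobenius norm `‖M‖_F = √(tr (M Mᵀ))`. -/
def frobeniusNorm {p n : ℕ} (M : Matrix (Fin p) (Fin n) ℝ) : ℝ :=
  Real.sqrt (M * M.transpose).trace

/-- The spectral norm: the operator norm of `M` between Euclidean spaces. -/
def spectralNorm {p n : ℕ} (M : Matrix (Fin p) (Fin n) ℝ) : ℝ :=
  letI := Matrix.instL2OpNormedAddCommGroup (m := Fin p) (n := Fin n) (𝕜 := ℝ)
  ‖M‖

/-- The nuclear norm `‖M‖_* = tr √(M Mᵀ)`, the square root being that of the functional calculus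
of symmetric matrices. -/
def nuclearNorm {p n : ℕ} (M : Matrix (Fin p) (Fin n) ℝ) : ℝ :=
  (cfc Real.sqrt (M * M.transpose)).trace

/-- A random matrix: a matrix-valued map with measurable entries (equivalently, a Borel map). -/
def IsRandomMatrix {Ω : Type*} [MeasurableSpace Ω] {p n : ℕ}
    (X : Ω → Matrix (Fin p) (Fin n) ℝ) : Prop :=
  ∀ i j, Measurable fun ω => X ω i j

/-- The expectation of a random matrix, taken entrywise. -/
def matrixMean {Ω : Type*} [MeasurableSpace Ω] (μ : Measure Ω) {p n : ℕ}
    (X : Ω → Matrix (Fin p) (Fin n) ℝ) : Matrix (Fin p) (Fin n) ℝ :=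
  Matrix.of fun i j => ∫ ω, X ω i j ∂μ

section Concentration

/- Families of random vectors `Z k : Ω k → E k`, where `E k` carries the norm `nrm k`. The index
set is arbitrary: for sequences take `ι = ℕ`. Constants never depend on the index. -/
variable {ι : Type*} {Ω : ι → Type*} [∀ k, MeasurableSpace (Ω k)]
  {E : ι → Type*} [∀ k, AddCommGroup (E k)] [∀ k, Module ℝ (E k)]

/-- Convex concentration `Z ∝_c 𝓔_q(σ)` in `(E, nrm)`: all observations of `Z` through
1-Lipschitz quasi-convex functions are integrable and `q`-exponentially concentrated around their
expectation with diameter `O(σ)`. -/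
def ConvexlyConcentrated (μ : ∀ k, Measure (Ω k)) (nrm : ∀ k, E k → ℝ)
    (Z : ∀ k, Ω k → E k) (q : ℝ) (σ : ι → ℝ) : Prop :=
  ∃ C c : ℝ, 0 < C ∧ 0 < c ∧ ∀ k, ∀ f : E k → ℝ,
    (∀ x y, |f x - f y| ≤ nrm k (x - y)) → QuasiconvexOn ℝ Set.univ f →
      Integrable (fun ω => f (Z k ω)) (μ k) ∧
      ∀ t : ℝ, 0 < t →
        (μ k).real {ω | t ≤ |f (Z k ω) - ∫ ω', f (Z k ω') ∂(μ k)|}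
          ≤ C * Real.exp (-(t / (c * σ k)) ^ q)

/-- Linear concentration `Z ∈ Z̃ ± 𝓔_q(σ)` in `(E, nrm)` around the deterministic family `Z̃`. -/
def LinearlyConcentratedAround (μ : ∀ k, Measure (Ω k)) (nrm : ∀ k, E k → ℝ)
    (Z : ∀ k, Ω k → E k) (Ztilde : ∀ k, E k) (q : ℝ) (σ : ι → ℝ) : Prop :=
  ∃ C c : ℝ, 0 < C ∧ 0 < c ∧ ∀ k, ∀ f : E k →ₗ[ℝ] ℝ, (∀ x, |f x| ≤ nrm k x) →
    ∀ t : ℝ, 0 < t →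
      (μ k).real {ω | t ≤ |f (Z k ω) - f (Ztilde k)|} ≤ C * Real.exp (-(t / (c * σ k)) ^ q)

/-- Linear concentration `Z ∈ 𝓔_q(σ)`: around some deterministic equivalent. -/
def LinearlyConcentrated (μ : ∀ k, Measure (Ω k)) (nrm : ∀ k, E k → ℝ)
    (Z : ∀ k, Ω k → E k) (q : ℝ) (σ : ι → ℝ) : Prop :=
  ∃ Ztilde : ∀ k, E k, LinearlyConcentratedAround μ nrm Z Ztilde q σ

/-- `A` is a family of events of positive probability with `ℙ(Aᶜ) ≤ C exp(-θ / c)`. -/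
def HighlyProbable (μ : ∀ k, Measure (Ω k)) (A : ∀ k, Set (Ω k)) (θ : ι → ℝ) : Prop :=
  (∀ k, MeasurableSet (A k) ∧ 0 < μ k (A k)) ∧
    ∃ C c : ℝ, 0 < C ∧ 0 < c ∧ ∀ k, (μ k).real (A k)ᶜ ≤ C * Real.exp (-(θ k / c))

/-- Convex concentration under a highly probable event, `Z ∝_c 𝓔_q(σ) | e^{-θ}`. -/
def ConvexlyConcentratedUnder (μ : ∀ k, Measure (Ω k)) (nrm : ∀ k, E k → ℝ)
    (Z : ∀ k, Ω k → E k) (q : ℝ) (σ θ : ι → ℝ) : Prop :=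
  ∃ A : ∀ k, Set (Ω k), HighlyProbable μ A θ ∧
    ConvexlyConcentrated (fun k => cond (μ k) (A k)) nrm Z q σ

/-- Linear concentration under a highly probable event, `Z ∈ 𝓔_q(σ) | e^{-θ}`. -/
def LinearlyConcentratedUnder (μ : ∀ k, Measure (Ω k)) (nrm : ∀ k, E k → ℝ)
    (Z : ∀ k, Ω k → E k) (q : ℝ) (σ θ : ι → ℝ) : Prop :=
  ∃ A : ∀ k, Set (Ω k), HighlyProbable μ A θ ∧
    LinearlyConcentrated (fun k => cond (μ k) (A k)) nrm Z q σ

end Concentration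

end MatrixConcentration

end

/-!
Let `f` be a linear form dominated by the nuclear norm. On the spectral ball of radius `κ` the
second differences of `X ↦ f (X ^ k)` are at most a multiple of `‖·‖_F ^ 2`, so adding a multiple of
`‖X‖_F ^ 2` makes this map convex: it is a difference of two convex functions that are Lipschitz on
the ball. Infimal convolution with the norm extends both to the whole space, keeping convexity and
the Lipschitz constants, so convex concentration applies to each of them. Conditioning on the
intersection of the given event with `{‖X‖ < κ}` and passing to the conditional mean gives the
claim when that intersection has probability at least `1 / 2`. Otherwise the bound required of
`ℙ(Gᶜ)` is trivial up to a factor 2, and any event `G` of positive probability on which the matrix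
is nearly constant will do. The Gram powers are blocks of the powers of the symmetric dilation of
`X`.
-/

open scoped NNReal

namespace MatrixConcentration

/-! ### Differences of convex functions -/

section LipschitzEnvelope

variable {α : Type*} [PseudoMetricSpace α]

/-- The infimal convolution of `h|_S` with `K * dist`: the McShane extension of `h|_S`, which for
convex `h` is again convex. -/
noncomputable def lipschitzEnvelope (K : ℝ≥0) (S : Set α) (h : α → ℝ) (x : α) : ℝ :=
  ⨅ y : S, (h y + K * dist x y)

variable {S : Set α} {h : α → ℝ} {K : ℝ≥0}

theorem bddBelow_range_add_mul_dist (hlip : LipschitzOnWith K h S) (x : α) :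
    BddBelow (Set.range fun y : S => h y + K * dist x y) := by
  rcases isEmpty_or_nonempty S with _ | ⟨⟨y₀, hy₀⟩⟩
  · simp
  · refine ⟨h y₀ - K * dist x y₀, ?_⟩
    rintro _ ⟨y, rfl⟩
    have h_lip : h y₀ ≤ h y + K * dist y₀ y := hlip.le_add_mul hy₀ y.2
    have h_tri : K * dist y₀ y ≤ K * (dist x y₀ + dist x y) := by
      gcongr
      exact dist_triangle_left _ _ _
    change h y₀ - K * dist x y₀ ≤ h y + K * dist x y
    linarith

theorem lipschitzEnvelope_le (hlip : LipschitzOnWith K h S) (x : α) {y : α} (hy : y ∈ S) :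
    lipschitzEnvelope K S h x ≤ h y + K * dist x y :=
  ciInf_le (bddBelow_range_add_mul_dist hlip x) ⟨y, hy⟩

theorem lipschitzWith_lipschitzEnvelope (hlip : LipschitzOnWith K h S) :
    LipschitzWith K (lipschitzEnvelope K S h) := by
  refine LipschitzWith.of_le_add_mul K fun x y => ?_
  rcases isEmpty_or_nonempty S with _ | _
  · simp only [lipschitzEnvelope, Real.iInf_of_isEmpty, zero_add]
    positivity
  · rw [← sub_le_iff_le_add]
    refine le_ciInf fun z => ?_
    have h_tri : K * dist x z ≤ K * (dist x y + dist y z) := by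
      gcongr
      exact dist_triangle _ _ _
    linarith [lipschitzEnvelope_le hlip x z.2]

theorem eqOn_lipschitzEnvelope (hlip : LipschitzOnWith K h S) :
    Set.EqOn h (lipschitzEnvelope K S h) S := by
  intro x hx
  have : Nonempty S := ⟨x, hx⟩
  refine le_antisymm (le_ciInf fun y => hlip.le_add_mul hx y.2) ?_
  simpa using lipschitzEnvelope_le hlip x hx

end LipschitzEnvelope

section ConvexDifference

variable {E E' : Type*} [NormedAddCommGroup E] [NormedSpace ℝ E]
  [NormedAddCommGroup E'] [NormedSpace ℝ E'] {S : Set E}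

theorem convexOn_univ_lipschitzEnvelope {h : E → ℝ} {K : ℝ≥0}
    (hlip : LipschitzOnWith K h S) (hconv : ConvexOn ℝ S h) :
    ConvexOn ℝ Set.univ (lipschitzEnvelope K S h) := by
  refine ⟨convex_univ, fun x₁ _ x₂ _ a b ha hb hab => ?_⟩
  rcases isEmpty_or_nonempty S with _ | _
  · simp [lipschitzEnvelope]
  refine le_of_forall_pos_le_add fun ε hε => ?_
  obtain ⟨⟨y₁, hy₁⟩, h_near₁⟩ :=
    exists_lt_of_ciInf_lt (lt_add_of_pos_right (lipschitzEnvelope K S h x₁) hε)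
  obtain ⟨⟨y₂, hy₂⟩, h_near₂⟩ :=
    exists_lt_of_ciInf_lt (lt_add_of_pos_right (lipschitzEnvelope K S h x₂) hε)
  have h_dist : dist (a • x₁ + b • x₂) (a • y₁ + b • y₂) ≤ a * dist x₁ y₁ + b * dist x₂ y₂ := by
    refine (dist_add_add_le _ _ _ _).trans_eq ?_
    rw [dist_smul₀, dist_smul₀, Real.norm_of_nonneg ha, Real.norm_of_nonneg hb]
  calc lipschitzEnvelope K S h (a • x₁ + b • x₂)
      ≤ h (a • y₁ + b • y₂) + K * dist (a • x₁ + b • x₂) (a • y₁ + b • y₂) :=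
        lipschitzEnvelope_le hlip _ (hconv.1 hy₁ hy₂ ha hb hab)
    _ ≤ (a • h y₁ + b • h y₂) + K * (a * dist x₁ y₁ + b * dist x₂ y₂) := by
        gcongr
        exact hconv.2 hy₁ hy₂ ha hb hab
    _ = a * (h y₁ + K * dist x₁ y₁) + b * (h y₂ + K * dist x₂ y₂) := by
        simp only [smul_eq_mul]
        ring
    _ ≤ a * (lipschitzEnvelope K S h x₁ + ε) + b * (lipschitzEnvelope K S h x₂ + ε) := by
        gcongr
    _ = a • lipschitzEnvelope K S h x₁ + b • lipschitzEnvelope K S h x₂ + ε := by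
        simp only [smul_eq_mul]
        linear_combination ε * hab

/-- On `S`, the function `g` is a difference of two convex `L`-Lipschitz functions. The constant is
a real number, to be read as `0` when negative. -/
def IsConvexDifferenceOn (S : Set E) (L : ℝ) (g : E → ℝ) : Prop :=
  ∃ h₁ h₂ : E → ℝ, (ConvexOn ℝ S h₁ ∧ LipschitzOnWith L.toNNReal h₁ S) ∧
    (ConvexOn ℝ S h₂ ∧ LipschitzOnWith L.toNNReal h₂ S) ∧ Set.EqOn g (h₁ - h₂) S

namespace IsConvexDifferenceOn

variable {L L' M : ℝ} {g : E → ℝ}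

theorem weaken (hg : IsConvexDifferenceOn S L g) (hL : L ≤ L') : IsConvexDifferenceOn S L' g := by
  obtain ⟨h₁, h₂, ⟨conv₁, lip₁⟩, ⟨conv₂, lip₂⟩, h_eq⟩ := hg
  exact ⟨h₁, h₂, ⟨conv₁, lip₁.weaken (Real.toNNReal_mono hL)⟩,
    ⟨conv₂, lip₂.weaken (Real.toNNReal_mono hL)⟩, h_eq⟩

theorem comp_linearMap {S' : Set E'} {g : E' → ℝ} (hg : IsConvexDifferenceOn S' L g)
    (T : E →ₗ[ℝ] E') (hS : Convex ℝ S) (hTS : Set.MapsTo T S S') (hL : 0 ≤ L)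
    (hT : ∀ x, ‖T x‖ ≤ M * ‖x‖) : IsConvexDifferenceOn S (L * M) (g ∘ T) := by
  obtain ⟨h₁, h₂, ⟨conv₁, lip₁⟩, ⟨conv₂, lip₂⟩, h_eq⟩ := hg
  have h_lip : LipschitzOnWith M.toNNReal T S :=
    (AddMonoidHomClass.lipschitz_of_bound T M hT).lipschitzOnWith
  rw [IsConvexDifferenceOn, Real.toNNReal_mul hL]
  exact ⟨h₁ ∘ T, h₂ ∘ T,
    ⟨(conv₁.comp_linearMap T).subset hTS hS, lip₁.comp h_lip hTS⟩,
    ⟨(conv₂.comp_linearMap T).subset hTS hS, lip₂.comp h_lip hTS⟩,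
    fun x hx => h_eq (hTS hx)⟩

theorem exists_eqOn_univ (hg : IsConvexDifferenceOn S L g) :
    ∃ g' : E → ℝ, IsConvexDifferenceOn Set.univ L g' ∧ Set.EqOn g g' S := by
  obtain ⟨h₁, h₂, ⟨conv₁, lip₁⟩, ⟨conv₂, lip₂⟩, h_eq⟩ := hg
  refine ⟨lipschitzEnvelope L.toNNReal S h₁ - lipschitzEnvelope L.toNNReal S h₂,
    ⟨_, _, ⟨convexOn_univ_lipschitzEnvelope lip₁ conv₁,
      (lipschitzWith_lipschitzEnvelope lip₁).lipschitzOnWith⟩,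
      ⟨convexOn_univ_lipschitzEnvelope lip₂ conv₂,
      (lipschitzWith_lipschitzEnvelope lip₂).lipschitzOnWith⟩, Set.eqOn_refl _ _⟩,
    fun x hx => ?_⟩
  rw [h_eq hx, Pi.sub_apply, Pi.sub_apply, eqOn_lipschitzEnvelope lip₁ hx,
    eqOn_lipschitzEnvelope lip₂ hx]

end IsConvexDifferenceOn

end ConvexDifference

/-! ### Powers in a normed algebra -/

section Powers

variable {A : Type*} [NormedRing A]

/-- Left and right multiplication by `x` have operator norm at most `κ`. For matrices with the
Frobenius norm this is the bound `κ` on the spectral norm. -/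
def MulBounded (κ : ℝ) (x : A) : Prop :=
  ∀ y, ‖x * y‖ ≤ κ * ‖y‖ ∧ ‖y * x‖ ≤ κ * ‖y‖

variable {κ : ℝ} {x y z : A}

theorem MulBounded.norm_le (hx : MulBounded κ x) : ‖x‖ ≤ κ * ‖(1 : A)‖ := by
  simpa using (hx 1).1

theorem MulBounded.pow (hκ : 0 ≤ κ) (hx : MulBounded κ x) (k : ℕ) : MulBounded (κ ^ k) (x ^ k) := by
  induction k with
  | zero => simp [MulBounded]
  | succ k ih =>
    intro y
    constructor
    · calc ‖x ^ (k + 1) * y‖ = ‖x ^ k * (x * y)‖ := by rw [pow_succ, mul_assoc]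
        _ ≤ κ ^ k * (κ * ‖y‖) := (ih _).1.trans (by gcongr; exact (hx y).1)
        _ = κ ^ (k + 1) * ‖y‖ := by ring
    · calc ‖y * x ^ (k + 1)‖ = ‖y * x ^ k * x‖ := by rw [pow_succ, mul_assoc]
        _ ≤ κ * (κ ^ k * ‖y‖) := (hx _).2.trans (by gcongr; exact (ih y).2)
        _ = κ ^ (k + 1) * ‖y‖ := by ring

theorem norm_pow_sub_pow_le (hκ : 0 ≤ κ) (hx : MulBounded κ x) (hy : MulBounded κ y) (k : ℕ) :
    ‖x ^ k - y ^ k‖ ≤ k * κ ^ (k - 1) * ‖x - y‖ := by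
  induction k with
  | zero => simp
  | succ k ih =>
    calc ‖x ^ (k + 1) - y ^ (k + 1)‖ = ‖x ^ k * (x - y) + (x ^ k - y ^ k) * y‖ := by
          rw [pow_succ, pow_succ]
          congr 1
          noncomm_ring
      _ ≤ κ ^ k * ‖x - y‖ + κ * (k * κ ^ (k - 1) * ‖x - y‖) := by
          refine (norm_add_le _ _).trans (add_le_add (hx.pow hκ k _).1 ((hy _).2.trans ?_))
          gcongr
      _ = ((k + 1 : ℕ) : ℝ) * κ ^ (k + 1 - 1) * ‖x - y‖ := by
          rcases k with _ | k
          · simp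
          · push_cast [Nat.add_sub_cancel]
            ring

variable [NormedAlgebra ℝ A]

theorem convex_setOf_mulBounded (κ : ℝ) : Convex ℝ {x : A | MulBounded κ x} := by
  simp only [MulBounded, Set.ofPred_forall, Set.ofPred_and]
  refine convex_iInter fun w => Convex.inter ?_ ?_
  · simpa [Set.preimage] using
      (convex_closedBall (0 : A) (κ * ‖w‖)).linear_preimage (LinearMap.mulRight ℝ w)
  · simpa [Set.preimage] using
      (convex_closedBall (0 : A) (κ * ‖w‖)).linear_preimage (LinearMap.mulLeft ℝ w)

theorem pow_sub_pow_eq_sum {R : Type*} [Ring R] (x z : R) (k : ℕ) :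
    x ^ k - z ^ k = ∑ j ∈ Finset.range k, x ^ j * (x - z) * z ^ (k - 1 - j) := by
  calc x ^ k - z ^ k
      = ∑ j ∈ Finset.range k, (x ^ (j + 1) * z ^ (k - (j + 1)) - x ^ j * z ^ (k - j)) := by
        rw [Finset.sum_range_sub fun j => x ^ j * z ^ (k - j)]
        simp
    _ = ∑ j ∈ Finset.range k, x ^ j * (x - z) * z ^ (k - 1 - j) := by
        refine Finset.sum_congr rfl fun j hj => ?_
        have h_exp : k - j = k - 1 - j + 1 := by grind
        rw [show k - (j + 1) = k - 1 - j by lia, h_exp, pow_succ x, pow_succ' z]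
        noncomm_ring

-- With `z = a • x + b • y`, the telescoping sums of `x ^ k - z ^ k` and `y ^ k - z ^ k` have
-- opposite leading terms, since `x - z = b • (x - y)` and `y - z = -a • (x - y)`.
theorem pow_jensen_gap_eq_sum {R : Type*} [Ring R] [Algebra ℝ R] (x y : R) {a b : ℝ}
    (hab : a + b = 1) (k : ℕ) :
    a • x ^ k + b • y ^ k - (a • x + b • y) ^ k =
      (a * b) • ∑ j ∈ Finset.range k,
        (x ^ j - y ^ j) * (x - y) * (a • x + b • y) ^ (k - 1 - j) := by
  obtain rfl : b = 1 - a := by linarith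
  set z := a • x + (1 - a) • y with hz
  have hx : x - z = (1 - a) • (x - y) := by
    rw [hz]
    module
  have hy : y - z = -a • (x - y) := by
    rw [hz]
    module
  calc a • x ^ k + (1 - a) • y ^ k - z ^ k = a • (x ^ k - z ^ k) + (1 - a) • (y ^ k - z ^ k) := by
        module
    _ = _ := by
        rw [pow_sub_pow_eq_sum x, pow_sub_pow_eq_sum y, hx, hy, Finset.smul_sum, Finset.smul_sum,
          Finset.smul_sum, ← Finset.sum_add_distrib]
        refine Finset.sum_congr rfl fun j _ => ?_
        simp only [mul_smul_comm, smul_mul_assoc, sub_mul]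
        module

theorem abs_apply_pow_jensen_gap_le {f : A →ₗ[ℝ] ℝ} (hf : ∀ x y, |f (x * y)| ≤ ‖x‖ * ‖y‖)
    (hκ : 0 ≤ κ) (hx : MulBounded κ x) (hy : MulBounded κ y) {a b : ℝ} (ha : 0 ≤ a) (hb : 0 ≤ b)
    (hab : a + b = 1) (k : ℕ) :
    |f (a • x ^ k + b • y ^ k - (a • x + b • y) ^ k)| ≤
      a * b * (k.choose 2 * κ ^ (k - 2) * ‖x - y‖ ^ 2) := by
  set z := a • x + b • y
  have hz : MulBounded κ z := convex_setOf_mulBounded κ hx hy ha hb hab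
  have h_term : ∀ j ∈ Finset.range k, |f ((x ^ j - y ^ j) * (x - y) * z ^ (k - 1 - j))| ≤
      j * (κ ^ (k - 2) * ‖x - y‖ ^ 2) := by
    intro j hj
    rcases Nat.eq_zero_or_pos j with rfl | hj0
    · simp
    calc |f ((x ^ j - y ^ j) * (x - y) * z ^ (k - 1 - j))|
        ≤ ‖x ^ j - y ^ j‖ * ‖(x - y) * z ^ (k - 1 - j)‖ := by
          rw [mul_assoc]
          exact hf _ _
      _ ≤ (j * κ ^ (j - 1) * ‖x - y‖) * (κ ^ (k - 1 - j) * ‖x - y‖) := by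
          gcongr
          · exact norm_pow_sub_pow_le hκ hx hy j
          · exact (hz.pow hκ _ _).2
      _ = j * (κ ^ (k - 2) * ‖x - y‖ ^ 2) := by
          have h_exp : k - 2 = (j - 1) + (k - 1 - j) := by grind
          rw [h_exp, pow_add]
          ring
  calc |f (a • x ^ k + b • y ^ k - z ^ k)|
      = a * b * |∑ j ∈ Finset.range k, f ((x ^ j - y ^ j) * (x - y) * z ^ (k - 1 - j))| := by
        rw [pow_jensen_gap_eq_sum x y hab, map_smul, map_sum, smul_eq_mul, abs_mul,
          abs_of_nonneg (mul_nonneg ha hb)]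
    _ ≤ a * b * ∑ j ∈ Finset.range k, j * (κ ^ (k - 2) * ‖x - y‖ ^ 2) := by
        gcongr
        exact (Finset.abs_sum_le_sum_abs _ _).trans (Finset.sum_le_sum h_term)
    _ = a * b * (k.choose 2 * κ ^ (k - 2) * ‖x - y‖ ^ 2) := by
        rw [← Finset.sum_mul, ← Nat.cast_sum, Finset.sum_range_id, Nat.choose_two_right,
          mul_assoc (_ : ℝ) (κ ^ _)]

theorem convexOn_apply_pow_add_norm_sq [InnerProductSpaceable A] {f : A →ₗ[ℝ] ℝ}
    (hf : ∀ x y, |f (x * y)| ≤ ‖x‖ * ‖y‖) (hκ : 0 ≤ κ) (k : ℕ) :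
    ConvexOn ℝ {x : A | MulBounded κ x}
      fun x => f (x ^ k) + k.choose 2 * κ ^ (k - 2) * ‖x‖ ^ 2 := by
  let _ : InnerProductSpace ℝ A := .ofNorm ℝ InnerProductSpaceable.parallelogram_identity
  have h_strong : StrongConvexOn {x : A | MulBounded κ x} (-2 * (k.choose 2 * κ ^ (k - 2)))
      fun x => f (x ^ k) := by
    refine ⟨convex_setOf_mulBounded κ, fun x hx y hy a b ha hb hab => ?_⟩
    have h_gap := (abs_le.1 (abs_apply_pow_jensen_gap_le hf hκ hx hy ha hb hab k)).1
    simp only [map_sub, map_add, map_smul, smul_eq_mul] at h_gap ⊢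
    linarith
  exact (strongConvexOn_iff_convex.1 h_strong).congr fun x _ => by ring

theorem lipschitzOnWith_apply_pow {f : A →ₗ[ℝ] ℝ} (hf : ∀ x y, |f (x * y)| ≤ ‖x‖ * ‖y‖)
    (hκ : 0 ≤ κ) (k : ℕ) :
    LipschitzOnWith (k * κ ^ (k - 1) * ‖(1 : A)‖).toNNReal (fun x => f (x ^ k))
      {x : A | MulBounded κ x} := by
  refine LipschitzOnWith.of_dist_le_mul fun x hx y hy => ?_
  rw [Real.coe_toNNReal _ (by positivity), dist_eq_norm, dist_eq_norm]
  calc ‖f (x ^ k) - f (y ^ k)‖ = |f ((x ^ k - y ^ k) * 1)| := by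
        rw [mul_one, map_sub, Real.norm_eq_abs]
    _ ≤ (k * κ ^ (k - 1) * ‖x - y‖) * ‖(1 : A)‖ :=
        (hf _ _).trans (by gcongr; exact norm_pow_sub_pow_le hκ hx hy k)
    _ = k * κ ^ (k - 1) * ‖(1 : A)‖ * ‖x - y‖ := by ring

theorem lipschitzOnWith_norm_sq {E : Type*} [SeminormedAddCommGroup E] {r c : ℝ} (hc : 0 ≤ c)
    (hr : 0 ≤ r) : LipschitzOnWith (2 * c * r).toNNReal (fun x : E => c * ‖x‖ ^ 2)
      {x | ‖x‖ ≤ r} := by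
  refine LipschitzOnWith.of_dist_le_mul fun x hx y hy => ?_
  rw [Real.coe_toNNReal _ (by positivity), dist_eq_norm, dist_eq_norm]
  calc ‖c * ‖x‖ ^ 2 - c * ‖y‖ ^ 2‖ = c * (‖x‖ + ‖y‖) * |‖x‖ - ‖y‖| := by
        rw [← mul_sub, sq_sub_sq, Real.norm_eq_abs, abs_mul, abs_mul, abs_of_nonneg hc,
          abs_of_nonneg (by positivity : 0 ≤ ‖x‖ + ‖y‖), mul_assoc]
    _ ≤ c * (r + r) * ‖x - y‖ := by
        gcongr
        exacts [hx, hy, abs_norm_sub_norm_le x y]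
    _ = 2 * c * r * ‖x - y‖ := by ring

-- Adding `k.choose 2 * κ ^ (k - 2) * ‖x‖ ^ 2` compensates the Jensen gap of the power.
theorem isConvexDifferenceOn_apply_pow [InnerProductSpaceable A] {f : A →ₗ[ℝ] ℝ}
    (hf : ∀ x y, |f (x * y)| ≤ ‖x‖ * ‖y‖) (hκ : 0 ≤ κ) (k : ℕ) :
    IsConvexDifferenceOn {x : A | MulBounded κ x} (k ^ 2 * κ ^ (k - 1) * ‖(1 : A)‖)
      fun x => f (x ^ k) := by
  have h_split : (k : ℝ) ^ 2 * κ ^ (k - 1) * ‖(1 : A)‖ = k * κ ^ (k - 1) * ‖(1 : A)‖ +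
      2 * (k.choose 2 * κ ^ (k - 2)) * (κ * ‖(1 : A)‖) := by
    rw [Nat.cast_choose_two]
    rcases k with _ | _ | k
    · simp
    · simp
    · push_cast [Nat.add_sub_cancel]
      ring
  have h_norm_sq : LipschitzOnWith (2 * (k.choose 2 * κ ^ (k - 2)) * (κ * ‖(1 : A)‖)).toNNReal
      (fun x : A => k.choose 2 * κ ^ (k - 2) * ‖x‖ ^ 2) {x | MulBounded κ x} :=
    (lipschitzOnWith_norm_sq (by positivity) (by positivity)).mono fun x hx => hx.norm_le
  have h_sum := (lipschitzOnWith_apply_pow hf hκ k).add h_norm_sq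
  rw [← Real.toNNReal_add (by positivity) (by positivity), ← h_split] at h_sum
  refine ⟨_, _, ⟨convexOn_apply_pow_add_norm_sq hf hκ k, h_sum⟩,
    ⟨?_, h_norm_sq.weaken (Real.toNNReal_mono ?_)⟩, fun x _ => (add_sub_cancel_right _ _).symm⟩
  · exact (((convexOn_norm (convex_setOf_mulBounded κ)).pow (fun _ _ => norm_nonneg _) 2).smul
      (by positivity : (0 : ℝ) ≤ k.choose 2 * κ ^ (k - 2)))
  · rw [h_split]
    exact le_add_of_nonneg_left (by positivity)

theorem sq_mul_pow_le_zpow (hκ : 0 < κ) (k : ℕ) :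
    k ^ 2 * κ ^ (k - 1) ≤ (2 * Real.exp 1 * κ) ^ ((k : ℤ) - 1) := by
  rcases k with _ | k
  · rw [Nat.cast_zero, zero_pow two_ne_zero, zero_mul]
    positivity
  have h_two_pow : ((k + 1 : ℕ) : ℝ) ≤ 2 ^ k := by
    exact_mod_cast Nat.lt_two_pow_self
  calc ((k + 1 : ℕ) : ℝ) ^ 2 * κ ^ k ≤ (2 ^ k) ^ 2 * κ ^ k := by gcongr
    _ = (2 * 2 * κ) ^ k := by rw [← pow_mul, mul_comm k, pow_mul, ← mul_pow, sq]
    _ ≤ (2 * Real.exp 1 * κ) ^ k := by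
        gcongr
        exact Real.exp_one_gt_two.le
    _ = (2 * Real.exp 1 * κ) ^ (((k + 1 : ℕ) : ℤ) - 1) := by simp

end Powers

/-! ### Matrix norms and the symmetric dilation -/

section Matrices

open Matrix

section SpectralNorm

open scoped Matrix.Norms.L2Operator

variable {p n : ℕ}

theorem spectralNorm_eq_norm (X : Matrix (Fin p) (Fin n) ℝ) : spectralNorm X = ‖X‖ := rfl

theorem continuous_spectralNorm : Continuous (spectralNorm : Matrix (Fin p) (Fin n) ℝ → ℝ) :=
  continuous_norm

theorem convex_spectralNorm_lt (κ : ℝ) :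
    Convex ℝ {X : Matrix (Fin p) (Fin n) ℝ | spectralNorm X < κ} := by
  have h_ball : {X : Matrix (Fin p) (Fin n) ℝ | spectralNorm X < κ} = Metric.ball 0 κ := by
    ext X
    simp [spectralNorm_eq_norm]
  exact h_ball ▸ convex_ball 0 κ

theorem isCompact_spectralNorm_le (κ : ℝ) :
    IsCompact {X : Matrix (Fin p) (Fin n) ℝ | spectralNorm X ≤ κ} := by
  have : ProperSpace (Matrix (Fin p) (Fin n) ℝ) := FiniteDimensional.proper ℝ _
  have h_ball : {X : Matrix (Fin p) (Fin n) ℝ | spectralNorm X ≤ κ} = Metric.closedBall 0 κ := by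
    ext X
    simp [spectralNorm_eq_norm]
  exact h_ball ▸ isCompact_closedBall 0 κ

theorem spectralNorm_nonneg (X : Matrix (Fin p) (Fin n) ℝ) : 0 ≤ spectralNorm X :=
  norm_nonneg X

theorem spectralNorm_transpose (X : Matrix (Fin p) (Fin n) ℝ) :
    spectralNorm Xᵀ = spectralNorm X := by
  rw [spectralNorm_eq_norm, spectralNorm_eq_norm, ← conjTranspose_eq_transpose_of_trivial,
    l2_opNorm_conjTranspose]

theorem sum_mulVec_sq_le (X : Matrix (Fin p) (Fin n) ℝ) (v : Fin n → ℝ) :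
    ∑ i, (X *ᵥ v) i ^ 2 ≤ spectralNorm X ^ 2 * ∑ j, v j ^ 2 := by
  have h_sq := pow_le_pow_left₀ (norm_nonneg _) (l2_opNorm_mulVec X (WithLp.toLp 2 v)) 2
  rw [mul_pow, EuclideanSpace.norm_sq_eq, EuclideanSpace.norm_sq_eq] at h_sq
  simpa [spectralNorm_eq_norm] using h_sq

end SpectralNorm

section Frobenius

open scoped Matrix.Norms.Frobenius

variable {l m n : Type*} [Fintype l] [Fintype m] [Fintype n]

theorem norm_sq_eq_sum (M : Matrix m n ℝ) : ‖M‖ ^ 2 = ∑ i, ∑ j, M i j ^ 2 := by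
  rw [frobenius_norm_def, ← Real.sqrt_eq_rpow, Real.sq_sqrt (by positivity)]
  simp

theorem norm_eq_sqrt_sum (M : Matrix m n ℝ) : ‖M‖ = √(∑ i, ∑ j, M i j ^ 2) := by
  rw [← norm_sq_eq_sum, Real.sqrt_sq (norm_nonneg M)]

theorem frobeniusNorm_eq_norm {p n : ℕ} (M : Matrix (Fin p) (Fin n) ℝ) : frobeniusNorm M = ‖M‖ := by
  simp [frobeniusNorm, norm_eq_sqrt_sum, trace, mul_apply, sq]

theorem norm_one_eq_sqrt_card [DecidableEq n] : ‖(1 : Matrix n n ℝ)‖ = √(Fintype.card n) := by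
  simpa using congrArg NNReal.toReal (frobenius_nnnorm_one (n := n) (α := ℝ))

theorem innerProductSpaceable_frobenius : InnerProductSpaceable (Matrix m n ℝ) where
  parallelogram_identity M N := by
    simp only [← sq, norm_sq_eq_sum, Finset.mul_sum, ← Finset.sum_add_distrib]
    refine Finset.sum_congr rfl fun i _ => Finset.sum_congr rfl fun j _ => ?_
    simp only [Matrix.add_apply, Matrix.sub_apply]
    ring

theorem sum_comp_le_sum_of_injective {e : m → n} (he : e.Injective) {g : n → ℝ}
    (hg : ∀ i, 0 ≤ g i) : ∑ i, g (e i) ≤ ∑ i, g i := by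
  simpa using Finset.sum_le_univ_sum_of_nonneg (s := Finset.univ.map ⟨e, he⟩) hg

theorem norm_submatrix_le {l' m' : Type*} [Fintype l'] [Fintype m'] (M : Matrix l m ℝ)
    {r : l' → l} {c : m' → m} (hr : r.Injective) (hc : c.Injective) : ‖M.submatrix r c‖ ≤ ‖M‖ := by
  simp only [norm_eq_sqrt_sum, submatrix_apply]
  gcongr
  calc ∑ i, ∑ j, M (r i) (c j) ^ 2 ≤ ∑ i, ∑ j, M (r i) j ^ 2 := by
        gcongr with i
        exact sum_comp_le_sum_of_injective hc fun j => sq_nonneg (M (r i) j)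
    _ ≤ ∑ i, ∑ j, M i j ^ 2 :=
        sum_comp_le_sum_of_injective hr fun i => Finset.sum_nonneg fun j _ => sq_nonneg (M i j)

end Frobenius

section NuclearNorm

open scoped Matrix.Norms.Frobenius

variable {p n : ℕ}

open scoped MatrixOrder in
theorem nuclearNorm_eq_trace {M : Matrix (Fin p) (Fin n) ℝ} {W : Matrix (Fin p) (Fin p) ℝ}
    (hW : W.PosSemidef) (h_sq : M * Mᵀ = W ^ 2) : nuclearNorm M = W.trace := by
  have h_nonneg : 0 ≤ W := hW.nonneg
  rw [nuclearNorm, h_sq, ← cfcₙ_eq_cfc, ← CFC.sqrt_eq_real_sqrt _ h_nonneg.isSelfAdjoint.sq_nonneg,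
    CFC.sqrt_sq W]

theorem nuclearNorm_vecMulVec (u : Fin p → ℝ) (v : Fin n → ℝ) :
    nuclearNorm (vecMulVec u v) = √(u ⬝ᵥ u) * √(v ⬝ᵥ v) := by
  have hu : √(u ⬝ᵥ u) ^ 2 = u ⬝ᵥ u := Real.sq_sqrt (dotProduct_self_star_nonneg u)
  have hv : √(v ⬝ᵥ v) ^ 2 = v ⬝ᵥ v := Real.sq_sqrt (dotProduct_self_star_nonneg v)
  rcases eq_or_ne u 0 with rfl | hu0
  · simp [nuclearNorm_eq_trace (W := 0) .zero]
  have hu_ne : √(u ⬝ᵥ u) ≠ 0 := fun h => hu0 (dotProduct_self_eq_zero.1 (by rw [← hu, h]; simp))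
  set a := √(u ⬝ᵥ u)
  set b := √(v ⬝ᵥ v)
  have h_pos : ((b / a) • vecMulVec u u).PosSemidef :=
    (posSemidef_vecMulVec_self_star u).smul (by positivity)
  rw [nuclearNorm_eq_trace h_pos]
  · rw [trace_smul, trace_vecMulVec, smul_eq_mul, ← hu]
    field_simp
  · rw [transpose_vecMulVec, vecMulVec_mul_vecMulVec, sq, Matrix.smul_mul, Matrix.mul_smul,
      vecMulVec_mul_vecMulVec, ← hu, ← hv, vecMulVec_smul, vecMulVec_smul, smul_smul, smul_smul]
    congr 1
    field_simp

-- `P * Q` is the sum over `k` of the rank-one matrices `(column k of P) (row k of Q)`.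
theorem abs_apply_mul_le_of_le_nuclearNorm {l : Type*} [Fintype l]
    {f : Matrix (Fin p) (Fin n) ℝ →ₗ[ℝ] ℝ} (hf : ∀ M, |f M| ≤ nuclearNorm M)
    (P : Matrix (Fin p) l ℝ) (Q : Matrix l (Fin n) ℝ) : |f (P * Q)| ≤ ‖P‖ * ‖Q‖ := by
  have h_rank_one : P * Q = ∑ k, vecMulVec (P.col k) (Q.row k) := by
    ext i j
    simp [mul_apply, Matrix.sum_apply, vecMulVec_apply]
  calc |f (P * Q)| ≤ ∑ k, |f (vecMulVec (P.col k) (Q.row k))| := by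
        rw [h_rank_one, map_sum]
        exact Finset.abs_sum_le_sum_abs _ _
    _ ≤ ∑ k, √(P.col k ⬝ᵥ P.col k) * √(Q.row k ⬝ᵥ Q.row k) :=
        Finset.sum_le_sum fun k _ => (hf _).trans_eq (nuclearNorm_vecMulVec _ _)
    _ ≤ √(∑ k, P.col k ⬝ᵥ P.col k) * √(∑ k, Q.row k ⬝ᵥ Q.row k) :=
        Real.sum_sqrt_mul_sqrt_le _ (fun k => dotProduct_self_star_nonneg (P.col k))
          fun k => dotProduct_self_star_nonneg (Q.row k)
    _ = ‖P‖ * ‖Q‖ := by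
        rw [norm_eq_sqrt_sum, norm_eq_sqrt_sum, Finset.sum_comm]
        simp [dotProduct, sq]

theorem abs_apply_le_of_le_nuclearNorm {f : Matrix (Fin p) (Fin n) ℝ →ₗ[ℝ] ℝ}
    (hf : ∀ M, |f M| ≤ nuclearNorm M) (M : Matrix (Fin p) (Fin n) ℝ) : |f M| ≤ √p * ‖M‖ := by
  simpa [norm_one_eq_sqrt_card] using abs_apply_mul_le_of_le_nuclearNorm hf 1 M

end NuclearNorm

section Dilation

open scoped Matrix.Norms.Frobenius

variable {m n : Type*}

/-- The symmetric dilation `[[0, X], [Xᵀ, 0]]` of `X`. Its powers have as blocks the matrices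
`(X * Xᵀ) ^ m` and `(X * Xᵀ) ^ m * X`. -/
def dilation : Matrix m n ℝ →ₗ[ℝ] Matrix (m ⊕ n) (m ⊕ n) ℝ where
  toFun X := fromBlocks 0 X Xᵀ 0
  map_add' X Y := by simp [fromBlocks_add]
  map_smul' c X := by simp [fromBlocks_smul]

theorem dilation_apply (X : Matrix m n ℝ) : dilation X = fromBlocks 0 X Xᵀ 0 := rfl

theorem transpose_dilation (X : Matrix m n ℝ) : (dilation X)ᵀ = dilation X := by
  simp [dilation_apply, fromBlocks_transpose]

variable [Fintype m] [Fintype n]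

theorem norm_dilation (X : Matrix m n ℝ) : ‖dilation X‖ = √2 * ‖X‖ := by
  have h_sq : ‖dilation X‖ ^ 2 = ‖X‖ ^ 2 + ‖Xᵀ‖ ^ 2 := by
    simp only [norm_sq_eq_sum, Fintype.sum_sum_type, dilation_apply]
    simp
  rw [← Real.sqrt_sq (norm_nonneg (dilation X)), h_sq, frobenius_norm_transpose, ← two_mul,
    Real.sqrt_mul zero_le_two, Real.sqrt_sq (norm_nonneg X)]

variable [DecidableEq m] [DecidableEq n]

theorem dilation_pow_two_mul (X : Matrix m n ℝ) (k : ℕ) :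
    dilation X ^ (2 * k) = fromBlocks ((X * Xᵀ) ^ k) 0 0 ((Xᵀ * X) ^ k) := by
  have h_sq : dilation X ^ 2 = fromBlocks (X * Xᵀ) 0 0 (Xᵀ * X) := by
    simp [sq, dilation_apply, fromBlocks_multiply]
  rw [pow_mul, h_sq, fromBlocks_diagonal_pow]

theorem dilation_pow_two_mul_add_one (X : Matrix m n ℝ) (k : ℕ) :
    dilation X ^ (2 * k + 1) =
      fromBlocks 0 ((X * Xᵀ) ^ k * X) ((Xᵀ * X) ^ k * Xᵀ) 0 := by
  rw [pow_succ, dilation_pow_two_mul]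
  simp [dilation_apply, fromBlocks_multiply]

end Dilation

section MatrixPowers

open scoped Matrix.Norms.Frobenius

variable {p n : ℕ} {κ : ℝ}

theorem norm_mul_sq_le_of_spectralNorm_le {l : Type*} [Fintype l] {X : Matrix (Fin p) (Fin n) ℝ}
    (hX : spectralNorm X ≤ κ) (P : Matrix (Fin n) l ℝ) : ‖X * P‖ ^ 2 ≤ κ ^ 2 * ‖P‖ ^ 2 := by
  rw [norm_sq_eq_sum, norm_sq_eq_sum, Finset.sum_comm,
    Finset.sum_comm (f := fun i j => P i j ^ 2), Finset.mul_sum]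
  refine Finset.sum_le_sum fun j _ => (sum_mulVec_sq_le X fun i => P i j).trans ?_
  gcongr
  exact spectralNorm_nonneg X

theorem mulBounded_of_forall_norm_mul_le {l : Type*} [Fintype l] [DecidableEq l]
    {M : Matrix l l ℝ} (h_mul : ∀ P : Matrix l l ℝ, ‖M * P‖ ≤ κ * ‖P‖)
    (h_transpose_mul : ∀ P : Matrix l l ℝ, ‖Mᵀ * P‖ ≤ κ * ‖P‖) : MulBounded κ M := by
  refine fun P => ⟨h_mul P, ?_⟩
  simpa only [← transpose_mul, frobenius_norm_transpose] using h_transpose_mul Pᵀ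

theorem norm_mul_le_of_spectralNorm_le {l : Type*} [Fintype l] {X : Matrix (Fin p) (Fin n) ℝ}
    (hX : spectralNorm X ≤ κ) (P : Matrix (Fin n) l ℝ) : ‖X * P‖ ≤ κ * ‖P‖ := by
  have hκ : 0 ≤ κ := (spectralNorm_nonneg X).trans hX
  refine le_of_sq_le_sq ?_ (by positivity)
  rw [mul_pow]
  exact norm_mul_sq_le_of_spectralNorm_le hX P

theorem mulBounded_of_spectralNorm_le {X : Matrix (Fin p) (Fin p) ℝ} (hX : spectralNorm X ≤ κ) :
    MulBounded κ X :=
  mulBounded_of_forall_norm_mul_le (norm_mul_le_of_spectralNorm_le hX)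
    (norm_mul_le_of_spectralNorm_le ((spectralNorm_transpose X).trans_le hX))

theorem mulBounded_dilation {X : Matrix (Fin p) (Fin n) ℝ} (hX : spectralNorm X ≤ κ) :
    MulBounded κ (dilation X) := by
  have hκ : 0 ≤ κ := (spectralNorm_nonneg X).trans hX
  have h_mul : ∀ P : Matrix (Fin p ⊕ Fin n) (Fin p ⊕ Fin n) ℝ,
      ‖dilation X * P‖ ≤ κ * ‖P‖ := by
    intro P
    refine le_of_sq_le_sq ?_ (by positivity)
    set U := P.submatrix Sum.inl id
    set V := P.submatrix Sum.inr id
    calc ‖dilation X * P‖ ^ 2 = ‖X * V‖ ^ 2 + ‖Xᵀ * U‖ ^ 2 := by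
          simp [norm_sq_eq_sum, Fintype.sum_sum_type, dilation_apply, mul_apply, U, V]
      _ ≤ κ ^ 2 * ‖V‖ ^ 2 + κ ^ 2 * ‖U‖ ^ 2 :=
          add_le_add (norm_mul_sq_le_of_spectralNorm_le hX V)
            (norm_mul_sq_le_of_spectralNorm_le ((spectralNorm_transpose X).trans_le hX) U)
      _ = (κ * ‖P‖) ^ 2 := by
          rw [mul_pow, ← mul_add, add_comm]
          simp [norm_sq_eq_sum, Fintype.sum_sum_type, U, V]
  exact mulBounded_of_forall_norm_mul_le h_mul (by rwa [transpose_dilation])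

theorem isConvexDifferenceOn_apply_matrix_pow (hκ : 0 < κ) {f : Matrix (Fin p) (Fin p) ℝ →ₗ[ℝ] ℝ}
    (hf : ∀ M, |f M| ≤ nuclearNorm M) (k : ℕ) :
    IsConvexDifferenceOn {X | spectralNorm X < κ}
      (√p * (2 * Real.exp 1 * κ) ^ ((k : ℤ) - 1)) fun X => f (X ^ k) := by
  have := innerProductSpaceable_frobenius (m := Fin p) (n := Fin p)
  have h_pow := isConvexDifferenceOn_apply_pow (abs_apply_mul_le_of_le_nuclearNorm hf) hκ.le k
  refine (h_pow.comp_linearMap LinearMap.id (convex_spectralNorm_lt κ)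
    (fun X hX => mulBounded_of_spectralNorm_le (le_of_lt hX)) (by positivity)
    (fun X => (one_mul ‖X‖).ge)).weaken ?_
  rw [norm_one_eq_sqrt_card, Fintype.card_fin, mul_one, mul_comm]
  gcongr
  exact sq_mul_pow_le_zpow hκ k

theorem abs_apply_submatrix_mul_le {l l' : Type*} [Fintype l] [Fintype l']
    {f : Matrix (Fin p) (Fin n) ℝ →ₗ[ℝ] ℝ} (hf : ∀ M, |f M| ≤ nuclearNorm M)
    {r : Fin p → l} {c : Fin n → l'} (hr : r.Injective) (hc : c.Injective)
    {k : Type*} [Fintype k] (P : Matrix l k ℝ) (Q : Matrix k l' ℝ) :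
    |f ((P * Q).submatrix r c)| ≤ ‖P‖ * ‖Q‖ := by
  rw [submatrix_mul P Q r id c Function.bijective_id]
  refine (abs_apply_mul_le_of_le_nuclearNorm hf _ _).trans ?_
  gcongr
  · exact norm_submatrix_le P hr Function.injective_id
  · exact norm_submatrix_le Q Function.injective_id hc

theorem isConvexDifferenceOn_apply_dilation_pow {p' n' : ℕ} (hκ : 0 < κ)
    {f : Matrix (Fin p') (Fin n') ℝ →ₗ[ℝ] ℝ} (hf : ∀ M, |f M| ≤ nuclearNorm M)
    {r : Fin p' → Fin p ⊕ Fin n} {c : Fin n' → Fin p ⊕ Fin n} (hr : r.Injective)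
    (hc : c.Injective) (k : ℕ) :
    IsConvexDifferenceOn {X : Matrix (Fin p) (Fin n) ℝ | spectralNorm X < κ}
      (√2 * (√(p + n) * (2 * Real.exp 1 * κ) ^ ((k : ℤ) - 1)))
      fun X => f ((dilation X ^ k).submatrix r c) := by
  have := innerProductSpaceable_frobenius (m := Fin p ⊕ Fin n) (n := Fin p ⊕ Fin n)
  let restrict : Matrix (Fin p ⊕ Fin n) (Fin p ⊕ Fin n) ℝ →ₗ[ℝ] Matrix (Fin p') (Fin n') ℝ :=
    { toFun := fun M => M.submatrix r c
      map_add' := fun _ _ => rfl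
      map_smul' := fun _ _ => rfl }
  have h_pow := isConvexDifferenceOn_apply_pow (f := f ∘ₗ restrict)
    (abs_apply_submatrix_mul_le hf hr hc) hκ.le k
  refine (h_pow.comp_linearMap dilation (convex_spectralNorm_lt κ)
    (fun X hX => mulBounded_dilation (le_of_lt hX)) (by positivity)
    (fun X => (norm_dilation X).le)).weaken ?_
  rw [norm_one_eq_sqrt_card, Fintype.card_sum, Fintype.card_fin, Fintype.card_fin, Nat.cast_add,
    mul_comm, mul_comm √(p + n : ℝ)]
  gcongr
  exact sq_mul_pow_le_zpow hκ k

theorem isConvexDifferenceOn_apply_gram_pow (hκ : 0 < κ) {f : Matrix (Fin p) (Fin p) ℝ →ₗ[ℝ] ℝ}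
    (hf : ∀ M, |f M| ≤ nuclearNorm M) (k : ℕ) :
    IsConvexDifferenceOn {X : Matrix (Fin p) (Fin n) ℝ | spectralNorm X < κ}
      (√2 * (√(p + n) * (2 * Real.exp 1 * κ) ^ (2 * (k : ℤ) - 1)))
      fun X => f ((X * Xᵀ) ^ k) := by
  have h_pow := isConvexDifferenceOn_apply_dilation_pow (p := p) (n := n) hκ hf
    Sum.inl_injective Sum.inl_injective (2 * k)
  simp only [dilation_pow_two_mul] at h_pow
  exact_mod_cast h_pow

theorem isConvexDifferenceOn_apply_gram_pow_mul (hκ : 0 < κ)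
    {f : Matrix (Fin p) (Fin n) ℝ →ₗ[ℝ] ℝ} (hf : ∀ M, |f M| ≤ nuclearNorm M) (k : ℕ) :
    IsConvexDifferenceOn {X : Matrix (Fin p) (Fin n) ℝ | spectralNorm X < κ}
      (√2 * (√(p + n) * (2 * Real.exp 1 * κ) ^ (2 * k)))
      fun X => f ((X * Xᵀ) ^ k * X) := by
  have h_pow := isConvexDifferenceOn_apply_dilation_pow (p := p) (n := n) hκ hf
    Sum.inl_injective Sum.inr_injective (2 * k + 1)
  simp only [dilation_pow_two_mul_add_one, Nat.cast_succ, add_sub_cancel_right,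
    zpow_natCast] at h_pow
  exact h_pow

end MatrixPowers

end Matrices

/-! ### Exponential tails of real random variables -/

section Tails

variable {Ω : Type*} [MeasurableSpace Ω] {μ ν : Measure Ω} {Y Y' : Ω → ℝ} {a a' C C' s q : ℝ}

/-- `Y` deviates from `a` with a `q`-exponential tail of scale `s` under the measure `ν`. At `s = 0`
the convention `t / 0 = 0` turns the bound into the constant `C`. -/
def HasTailBound (ν : Measure Ω) (Y : Ω → ℝ) (a C s q : ℝ) : Prop :=
  ∀ t, 0 < t → ν.real {ω | t ≤ |Y ω - a|} ≤ C * Real.exp (-(t / s) ^ q)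

theorem HasTailBound.mono (h : HasTailBound ν Y a C s q) (hC : C ≤ C') :
    HasTailBound ν Y a C' s q :=
  fun t ht => (h t ht).trans (by gcongr)

theorem HasTailBound.const_mul {L : ℝ} (hL : 0 < L) (h : HasTailBound ν Y a C s q) :
    HasTailBound ν (fun ω => L * Y ω) (L * a) C (L * s) q := by
  intro t ht
  have hset : {ω | t ≤ |L * Y ω - L * a|} = {ω | t / L ≤ |Y ω - a|} := by
    ext ω
    rw [Set.mem_ofPred_eq, Set.mem_ofPred_eq, ← mul_sub, abs_mul, abs_of_pos hL, div_le_iff₀' hL]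
  rw [hset, ← div_div]
  exact h (t / L) (by positivity)

theorem HasTailBound.sub [IsFiniteMeasure ν] (h : HasTailBound ν Y a C s q)
    (h' : HasTailBound ν Y' a' C' s q) :
    HasTailBound ν (Y - Y') (a - a') (C + C') (2 * s) q := by
  intro t ht
  have hsub : {ω | t ≤ |(Y - Y') ω - (a - a')|}
      ⊆ {ω | t / 2 ≤ |Y ω - a|} ∪ {ω | t / 2 ≤ |Y' ω - a'|} := by
    intro ω hω
    simp only [Set.mem_ofPred_eq, Set.mem_union, Pi.sub_apply, sub_sub_sub_comm] at hω ⊢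
    by_contra! hcon
    linarith [abs_sub (Y ω - a) (Y' ω - a'), hcon.1, hcon.2]
  calc ν.real {ω | t ≤ |(Y - Y') ω - (a - a')|}
      ≤ ν.real {ω | t / 2 ≤ |Y ω - a|} + ν.real {ω | t / 2 ≤ |Y' ω - a'|} :=
        (measureReal_mono hsub).trans (measureReal_union_le _ _)
    _ ≤ C * Real.exp (-(t / 2 / s) ^ q) + C' * Real.exp (-(t / 2 / s) ^ q) :=
        add_le_add (h _ (half_pos ht)) (h' _ (half_pos ht))
    _ = (C + C') * Real.exp (-(t / (2 * s)) ^ q) := by rw [div_div, add_mul]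

theorem cond_real_mul_eq_inter [IsFiniteMeasure μ] {A : Set Ω} (hA : MeasurableSet A) (B : Set Ω) :
    μ[|A].real B * μ.real A = μ.real (A ∩ B) := by
  rw [measureReal_def, measureReal_def, measureReal_def, ← ENNReal.toReal_mul,
    cond_mul_eq_inter hA B μ]

theorem HasTailBound.cond_of_half_le [IsProbabilityMeasure μ] {A G : Set Ω} (hA : MeasurableSet A)
    (hG : MeasurableSet G) (hGA : G ⊆ A) (hhalf : 1 / 2 ≤ μ.real G) (hY : Set.EqOn Y Y' G)
    (h : HasTailBound μ[|A] Y a C s q) : HasTailBound μ[|G] Y' a (2 * C) s q := by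
  intro t ht
  have hinter : G ∩ {ω | t ≤ |Y' ω - a|} ⊆ A ∩ {ω | t ≤ |Y ω - a|} := by
    rintro ω ⟨hωG, hω⟩
    rw [Set.mem_ofPred_eq, ← hY hωG] at hω
    exact ⟨hGA hωG, hω⟩
  have hle : μ[|G].real {ω | t ≤ |Y' ω - a|} * (1 / 2) ≤ μ[|A].real {ω | t ≤ |Y ω - a|} :=
    calc μ[|G].real {ω | t ≤ |Y' ω - a|} * (1 / 2)
        ≤ μ[|G].real {ω | t ≤ |Y' ω - a|} * μ.real G := by gcongr
      _ = μ.real (G ∩ {ω | t ≤ |Y' ω - a|}) := cond_real_mul_eq_inter hG _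
      _ ≤ μ.real (A ∩ {ω | t ≤ |Y ω - a|}) := measureReal_mono hinter
      _ = μ[|A].real {ω | t ≤ |Y ω - a|} * μ.real A := (cond_real_mul_eq_inter hA _).symm
      _ ≤ μ[|A].real {ω | t ≤ |Y ω - a|} :=
          mul_le_of_le_one_right measureReal_nonneg measureReal_le_one
  linarith [h t ht]

theorem hasTailBound_zero_scale [IsProbabilityMeasure ν] (hq : q ≠ 0) (Y : Ω → ℝ) (a : ℝ) :
    HasTailBound ν Y a 1 0 q := by
  intro t _
  simpa only [div_zero, Real.zero_rpow hq, neg_zero, Real.exp_zero, mul_one]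
    using measureReal_le_one

theorem one_le_exp_mul_exp_neg_div_rpow {t M : ℝ} (hq : 0 ≤ q) (hs : 0 < s) (ht : 0 ≤ t)
    (htM : t ≤ M * s) : 1 ≤ Real.exp (M ^ q) * Real.exp (-(t / s) ^ q) := by
  rw [← Real.exp_add, Real.one_le_exp_iff, ← sub_eq_add_neg, sub_nonneg]
  exact Real.rpow_le_rpow (by positivity) ((div_le_iff₀ hs).mpr htM) hq

theorem hasTailBound_of_ae_abs_sub_lt [IsProbabilityMeasure ν] (hq : 0 ≤ q) (hs : 0 < s)
    (h : ∀ᵐ ω ∂ν, |Y ω - a| < s) : HasTailBound ν Y a (Real.exp 1) s q := by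
  intro t ht
  rcases le_or_gt t s with hts | hts
  · have hone := one_le_exp_mul_exp_neg_div_rpow hq hs ht.le (M := 1) (by rwa [one_mul])
    rw [Real.one_rpow] at hone
    exact measureReal_le_one.trans hone
  · have hzero : ν {ω | t ≤ |Y ω - a|} = 0 := by
      refine measure_eq_zero_iff_ae_notMem.mpr (h.mono fun ω hω hmem => ?_)
      exact absurd (hω.trans hts) hmem.not_gt
    rw [measureReal_def, hzero, ENNReal.toReal_zero]
    positivity

theorem integrableOn_exp_neg_div_rpow (hq : 0 < q) (hs : 0 < s) :
    IntegrableOn (fun t : ℝ => Real.exp (-(t / s) ^ q)) (Set.Ioi 0) := by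
  have hunit : IntegrableOn (fun t : ℝ => Real.exp (-t ^ q)) (Set.Ioi 0) := by
    simpa only [Real.rpow_zero, one_mul]
      using integrableOn_rpow_mul_exp_neg_rpow (p := q) (s := 0) (by norm_num) hq
  have hscaled := (integrableOn_Ioi_comp_mul_left_iff (fun t : ℝ => Real.exp (-t ^ q)) 0
    (inv_pos.mpr hs)).mpr (by rwa [mul_zero])
  simpa only [div_eq_inv_mul] using hscaled

theorem integral_exp_neg_div_rpow (hq : 0 < q) (hs : 0 < s) :
    ∫ t in Set.Ioi (0 : ℝ), Real.exp (-(t / s) ^ q) = s * Real.Gamma (1 / q + 1) := by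
  have h := integral_comp_mul_left_Ioi (fun t : ℝ => Real.exp (-t ^ q)) 0 (inv_pos.mpr hs)
  simp only [mul_zero, integral_exp_neg_rpow hq, inv_inv, smul_eq_mul] at h
  simpa only [div_eq_inv_mul] using h

theorem HasTailBound.abs_integral_sub_le [IsProbabilityMeasure ν] (hY : Integrable Y ν)
    (hq : 0 < q) (hs : 0 < s) (h : HasTailBound ν Y a C s q) :
    |∫ ω, Y ω ∂ν - a| ≤ C * Real.Gamma (1 / q + 1) * s := by
  have hYa : Integrable (fun ω => Y ω - a) ν := hY.sub (integrable_const a)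
  calc |∫ ω, Y ω ∂ν - a| = |∫ ω, (Y ω - a) ∂ν| := by
        rw [integral_sub hY (integrable_const a), integral_const, probReal_univ, one_smul]
    _ ≤ ∫ ω, |Y ω - a| ∂ν := abs_integral_le_integral_abs
    _ = ∫ t in Set.Ioi 0, ν.real {ω | t ≤ |Y ω - a|} :=
        hYa.abs.integral_eq_integral_meas_le (Filter.Eventually.of_forall fun _ => abs_nonneg _)
    _ ≤ ∫ t in Set.Ioi 0, C * Real.exp (-(t / s) ^ q) := by
        refine integral_mono_of_nonneg (Filter.Eventually.of_forall fun _ => measureReal_nonneg)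
          ((integrableOn_exp_neg_div_rpow hq hs).const_mul C) ?_
        filter_upwards [ae_restrict_mem measurableSet_Ioi] with t ht using h t ht
    _ = C * Real.Gamma (1 / q + 1) * s := by
        rw [integral_const_mul, integral_exp_neg_div_rpow hq hs]
        ring

/-- The prefactor of the tail bound around the mean of a variable that has, around some other
centre, a `q`-exponential tail with prefactor `C`. -/
noncomputable def meanTailConst (C q : ℝ) : ℝ :=
  C + Real.exp ((C * Real.Gamma (1 / q + 1)) ^ q)

theorem HasTailBound.integral [IsProbabilityMeasure ν] (hY : Integrable Y ν) (hC : 0 ≤ C)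
    (hq : 0 < q) (hs : 0 < s) (h : HasTailBound ν Y a C s q) :
    HasTailBound ν Y (∫ ω, Y ω ∂ν) (meanTailConst C q) (2 * s) q := by
  intro t ht
  have hmean := h.abs_integral_sub_le hY hq hs
  set M := C * Real.Gamma (1 / q + 1) with hM
  rw [meanTailConst, ← hM, add_mul]
  rcases le_or_gt t (M * (2 * s)) with htM | htM
  · have hone := one_le_exp_mul_exp_neg_div_rpow hq.le (by positivity) ht.le htM
    exact (measureReal_le_one.trans hone).trans (le_add_of_nonneg_left (by positivity))
  · have hsub : {ω | t ≤ |Y ω - ∫ ω', Y ω' ∂ν|} ⊆ {ω | t / 2 ≤ |Y ω - a|} := by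
      intro ω hω
      simp only [Set.mem_ofPred_eq] at hω ⊢
      linarith [abs_sub_le (Y ω) a (∫ ω', Y ω' ∂ν), abs_sub_comm a (∫ ω', Y ω' ∂ν)]
    have htail := (measureReal_mono hsub).trans (h (t / 2) (half_pos ht))
    rw [div_div] at htail
    exact htail.trans (le_add_of_nonneg_right (by positivity))

end Tails

/-! ### From convex to linear concentration -/

section Transfer

variable {Ω : Type*} [MeasurableSpace Ω] {μ ν : Measure Ω} {C s q : ℝ} {L : ℝ}

theorem exists_event_dist_lt {E : Type*} [PseudoMetricSpace E] {Z : Ω → E}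
    (hZ : StronglyMeasurable Z) (hμ : μ ≠ 0) {δ : ℝ} (hδ : 0 < δ) :
    ∃ (H : Set Ω) (z : E), MeasurableSet H ∧ 0 < μ H ∧ ∀ ω ∈ H, dist (Z ω) z < δ := by
  obtain ⟨D, hD, hcover⟩ := hZ.isSeparable_range
  by_contra! hnull
  have hball : ∀ z, μ {ω | dist (Z ω) z < δ} = 0 := by
    intro z
    have hmeas : MeasurableSet {ω | dist (Z ω) z < δ} :=
      measurableSet_lt (hZ.dist stronglyMeasurable_const).measurable measurable_const
    by_contra hne
    obtain ⟨ω, hω, hfar⟩ := hnull _ z hmeas (pos_iff_ne_zero.mpr hne)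
    exact hfar.not_gt hω
  refine hμ (Measure.measure_univ_eq_zero.mp (measure_mono_null ?_
    ((measure_biUnion_null_iff hD).mpr fun z _ => hball z)))
  intro ω _
  obtain ⟨z, hzD, hz⟩ := Metric.mem_closure_iff.mp (hcover (Set.mem_range_self ω)) δ hδ
  exact Set.mem_biUnion hzD hz

theorem integrable_cond_of_isBounded_image [IsFiniteMeasure μ] {E : Type*} [NormedAddCommGroup E]
    {Z : Ω → E} {G : Set Ω} (hG : MeasurableSet G) (hZ : StronglyMeasurable Z)
    (hbdd : Bornology.IsBounded (Z '' G)) : Integrable Z μ[|G] := by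
  obtain ⟨B, hB⟩ := hbdd.exists_norm_le
  refine Integrable.of_bound hZ.aestronglyMeasurable B ?_
  exact ae_cond_of_forall_mem hG fun ω hω => hB _ (Set.mem_image_of_mem Z hω)

variable {E E' : Type*} [NormedAddCommGroup E] [NormedSpace ℝ E]
  [NormedAddCommGroup E'] [NormedSpace ℝ E'] {X : Ω → E} {F : E → E'} {S : Set E} {A G : Set Ω}

/-- All observations of `X` through 1-Lipschitz quasi-convex functions have `q`-exponential tails
of scale `s` around some constant: convex concentration of a single random vector, with explicit
constants. -/
def HasConvexTailBounds (ν : Measure Ω) (X : Ω → E) (C s q : ℝ) : Prop :=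
  ∀ f : E → ℝ, LipschitzWith 1 f → QuasiconvexOn ℝ Set.univ f →
    ∃ a, HasTailBound ν (fun ω => f (X ω)) a C s q

theorem HasConvexTailBounds.exists_of_convexOn (hX : HasConvexTailBounds ν X C s q) (hL : 0 < L)
    {h : E → ℝ} (hconv : ConvexOn ℝ Set.univ h) (hlip : LipschitzWith L.toNNReal h) :
    ∃ a, HasTailBound ν (fun ω => h (X ω)) a C (L * s) q := by
  have hlip' : LipschitzWith 1 fun x => L⁻¹ * h x := by
    refine LipschitzWith.of_dist_le_mul fun x y => ?_
    rw [NNReal.coe_one, one_mul, Real.dist_eq, ← mul_sub, abs_mul, abs_of_pos (inv_pos.mpr hL),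
      inv_mul_le_iff₀ hL]
    simpa only [Real.dist_eq, Real.coe_toNNReal L hL.le] using hlip.dist_le_mul x y
  obtain ⟨a, ha⟩ := hX _ hlip' (hconv.smul (inv_pos.mpr hL).le).quasiconvexOn
  refine ⟨L * a, ?_⟩
  simpa only [mul_inv_cancel_left₀ hL.ne'] using ha.const_mul hL

theorem HasConvexTailBounds.exists_of_isConvexDifferenceOn [IsFiniteMeasure ν]
    (hX : HasConvexTailBounds ν X C s q) (hL : 0 < L) {g : E → ℝ}
    (hg : IsConvexDifferenceOn Set.univ L g) :
    ∃ a, HasTailBound ν (fun ω => g (X ω)) a (2 * C) (2 * (L * s)) q := by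
  obtain ⟨h₁, h₂, ⟨hconv₁, hlip₁⟩, ⟨hconv₂, hlip₂⟩, hg⟩ := hg
  obtain ⟨a₁, ha₁⟩ := hX.exists_of_convexOn hL hconv₁ (lipschitzOnWith_univ.mp hlip₁)
  obtain ⟨a₂, ha₂⟩ := hX.exists_of_convexOn hL hconv₂ (lipschitzOnWith_univ.mp hlip₂)
  refine ⟨a₁ - a₂, ?_⟩
  rw [(Set.eqOn_univ _ _).mp hg, two_mul C]
  exact ha₁.sub ha₂

theorem HasConvexTailBounds.hasTailBound_integral_cond [IsProbabilityMeasure μ]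
    (hA : MeasurableSet A) (hX : HasConvexTailBounds μ[|A] X C s q) (hC : 0 ≤ C) (hs : 0 < s)
    (hq : 0 < q) (hG : MeasurableSet G) (hGA : G ⊆ A) (hhalf : 1 / 2 ≤ μ.real G)
    (hGS : Set.MapsTo X G S) {g : E → ℝ} (hL : 0 < L) (hg : IsConvexDifferenceOn S L g)
    (hint : Integrable (fun ω => g (X ω)) μ[|G]) :
    HasTailBound μ[|G] (fun ω => g (X ω)) (∫ ω, g (X ω) ∂μ[|G]) (meanTailConst (4 * C) q)
      (4 * (L * s)) q := by
  have hprob : IsProbabilityMeasure μ[|G] :=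
    cond_isProbabilityMeasure (ENNReal.toReal_pos_iff.mp (one_half_pos.trans_le hhalf)).1.ne'
  obtain ⟨g', hg', hgg'⟩ := hg.exists_eqOn_univ
  obtain ⟨a, ha⟩ := hX.exists_of_isConvexDifferenceOn hL hg'
  have hcond : HasTailBound μ[|G] (fun ω => g (X ω)) a (2 * (2 * C)) (2 * (L * s)) q :=
    ha.cond_of_half_le hA hG hGA hhalf fun ω hω => (hgg' (hGS hω)).symm
  convert hcond.integral hint (by positivity) hq (by positivity) using 1
  · congr 1
    ring
  · ring

theorem exists_event_hasTailBound_of_stronglyMeasurable [IsProbabilityMeasure μ] {Z : Ω → E'}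
    (hZ : StronglyMeasurable Z) (hq : 0 ≤ q) (hs : 0 < s) {Φ : Set (E' →ₗ[ℝ] ℝ)} {K : ℝ}
    (hΦ : ∀ f ∈ Φ, ∀ x, |f x| ≤ K * ‖x‖) :
    ∃ (H : Set Ω) (z : E'), MeasurableSet H ∧ 0 < μ H ∧
      ∀ f ∈ Φ, HasTailBound μ[|H] (fun ω => f (Z ω)) (f z) (Real.exp 1) s q := by
  have hK : 0 < max K 1 := lt_max_of_lt_right one_pos
  obtain ⟨H, z, hH, hpos, hnear⟩ :=
    exists_event_dist_lt hZ (IsProbabilityMeasure.ne_zero μ) (div_pos hs hK)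
  have hprob : IsProbabilityMeasure μ[|H] := cond_isProbabilityMeasure hpos.ne'
  refine ⟨H, z, hH, hpos, fun f hf => hasTailBound_of_ae_abs_sub_lt hq hs ?_⟩
  refine ae_cond_of_forall_mem hH fun ω hω => ?_
  calc |f (Z ω) - f z| = |f (Z ω - z)| := by rw [map_sub]
    _ ≤ K * ‖Z ω - z‖ := hΦ f hf _
    _ ≤ max K 1 * dist (Z ω) z := by
        rw [dist_eq_norm]
        gcongr
        exact le_max_left K 1
    _ < max K 1 * (s / max K 1) := by
        gcongr
        exact hnear ω hω
    _ = s := mul_div_cancel₀ s hK.ne'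

theorem exists_event_hasTailBound_of_isConvexDifferenceOn [CompleteSpace E']
    [IsProbabilityMeasure μ] (hA : MeasurableSet A) (hX : HasConvexTailBounds μ[|A] X C s q)
    (hC : 0 ≤ C) (hs : 0 < s) (hq : 0 < q) (hS : MeasurableSet (X ⁻¹' S))
    (hFX : StronglyMeasurable fun ω => F (X ω)) (hF : Bornology.IsBounded (F '' S))
    {Φ : Set (E' →ₗ[ℝ] ℝ)} {K : ℝ} (hΦ : ∀ f ∈ Φ, ∀ x, |f x| ≤ K * ‖x‖) (hL : 0 ≤ L)
    (hdec : ∀ f ∈ Φ, IsConvexDifferenceOn S L fun x => f (F x)) :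
    ∃ (G : Set Ω) (z : E'), (MeasurableSet G ∧ 0 < μ G) ∧
      μ.real Gᶜ ≤ 2 * μ.real (A ∩ X ⁻¹' S)ᶜ ∧
      ∀ f ∈ Φ, HasTailBound μ[|G] (fun ω => f (F (X ω))) (f z)
        (meanTailConst (4 * C) q + Real.exp 1) (4 * (L * s)) q := by
  have hconst : 0 < meanTailConst (4 * C) q := by
    unfold meanTailConst
    positivity
  rcases hL.eq_or_lt with rfl | hL
  · refine ⟨Set.univ, 0, ⟨.univ, by simp⟩, by simp, fun f _ => ?_⟩
    rw [zero_mul, mul_zero, cond_univ]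
    refine (hasTailBound_zero_scale hq.ne' _ _).mono ?_
    linarith [Real.one_le_exp zero_le_one]
  have hG : MeasurableSet (A ∩ X ⁻¹' S) := hA.inter hS
  rcases le_or_gt (1 / 2) (μ.real (A ∩ X ⁻¹' S)) with hhalf | hhalf
  · have himage : (fun ω => F (X ω)) '' (A ∩ X ⁻¹' S) ⊆ F '' S := by
      rintro _ ⟨ω, hω, rfl⟩
      exact Set.mem_image_of_mem F hω.2
    have hint := integrable_cond_of_isBounded_image (μ := μ) hG hFX (hF.subset himage)
    refine ⟨_, ∫ ω, F (X ω) ∂μ[|A ∩ X ⁻¹' S], ⟨hG, ?_⟩, ?_, fun f hf => ?_⟩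
    · exact (ENNReal.toReal_pos_iff.mp (one_half_pos.trans_le hhalf)).1
    · linarith [measureReal_nonneg (μ := μ) (s := (A ∩ X ⁻¹' S)ᶜ)]
    · set f' : E' →L[ℝ] ℝ := f.mkContinuous K (hΦ f hf)
      have hmean : f (∫ ω, F (X ω) ∂μ[|A ∩ X ⁻¹' S]) = ∫ ω, f (F (X ω)) ∂μ[|A ∩ X ⁻¹' S] :=
        (f'.integral_comp_comm hint).symm
      rw [hmean]
      exact (hX.hasTailBound_integral_cond hA hC hs hq hG Set.inter_subset_left hhalf
        Set.inter_subset_right hL (hdec f hf) (f'.integrable_comp hint)).mono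
        (le_add_of_nonneg_right (Real.exp_pos 1).le)
  · obtain ⟨H, z, hH, hpos, htail⟩ := exists_event_hasTailBound_of_stronglyMeasurable (μ := μ)
      hFX hq.le (by positivity : 0 < 4 * (L * s)) hΦ
    refine ⟨H, z, ⟨hH, hpos⟩, ?_, fun f hf => (htail f hf).mono (le_add_of_nonneg_left hconst.le)⟩
    linarith [measureReal_le_one (μ := μ) (s := Hᶜ), probReal_add_probReal_compl (μ := μ) hG]

end Transfer

/-! ### Families of random matrices -/

section RandomMatrix

open scoped Matrix.Norms.Frobenius

variable {Ω : Type*} [MeasurableSpace Ω] {p n : ℕ} {X : Ω → Matrix (Fin p) (Fin n) ℝ}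

theorem IsRandomMatrix.stronglyMeasurable (hX : IsRandomMatrix X) : StronglyMeasurable X := by
  have hpi : Measurable fun ω i j => X ω i j :=
    measurable_pi_iff.mpr fun i => measurable_pi_iff.mpr fun j => hX i j
  have hof : Continuous (Matrix.of : (Fin p → Fin n → ℝ) → Matrix (Fin p) (Fin n) ℝ) :=
    continuous_id
  exact hof.comp_stronglyMeasurable hpi.stronglyMeasurable

theorem IsRandomMatrix.measurableSet_spectralNorm_lt (hX : IsRandomMatrix X) (κ : ℝ) :
    MeasurableSet (X ⁻¹' {M | spectralNorm M < κ}) :=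
  (continuous_spectralNorm.comp_stronglyMeasurable hX.stronglyMeasurable).measurable
    measurableSet_Iio

theorem isBounded_image_spectralNorm_lt {p' n' : ℕ}
    {F : Matrix (Fin p) (Fin n) ℝ → Matrix (Fin p') (Fin n') ℝ} (hF : Continuous F) (κ : ℝ) :
    Bornology.IsBounded (F '' {M | spectralNorm M < κ}) := by
  refine ((isCompact_spectralNorm_le κ).image hF).isBounded.subset (Set.image_mono ?_)
  exact Set.ofPred_subset_ofPred.mpr fun _ => le_of_lt

theorem exists_event_hasTailBound_of_le_nuclearNorm {μ : Measure Ω} [IsProbabilityMeasure μ]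
    {p' n' : ℕ} {F : Matrix (Fin p) (Fin n) ℝ → Matrix (Fin p') (Fin n') ℝ} (hF : Continuous F)
    (hX : IsRandomMatrix X) {A : Set Ω} (hA : MeasurableSet A) {C s q κ L : ℝ} (hC : 0 ≤ C)
    (hs : 0 < s) (hq : 0 < q) (hL : 0 ≤ L) (hconc : HasConvexTailBounds μ[|A] X C s q)
    (hdec : ∀ f : Matrix (Fin p') (Fin n') ℝ →ₗ[ℝ] ℝ, (∀ M, |f M| ≤ nuclearNorm M) →
      IsConvexDifferenceOn {M | spectralNorm M < κ} L fun M => f (F M)) :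
    ∃ (G : Set Ω) (Z : Matrix (Fin p') (Fin n') ℝ), (MeasurableSet G ∧ 0 < μ G) ∧
      μ.real Gᶜ ≤ 2 * μ.real (A ∩ X ⁻¹' {M | spectralNorm M < κ})ᶜ ∧
      ∀ f : Matrix (Fin p') (Fin n') ℝ →ₗ[ℝ] ℝ, (∀ M, |f M| ≤ nuclearNorm M) →
        HasTailBound μ[|G] (fun ω => f (F (X ω))) (f Z) (meanTailConst (4 * C) q + Real.exp 1)
          (4 * (L * s)) q := by
  exact exists_event_hasTailBound_of_isConvexDifferenceOn
    (Φ := {f : Matrix (Fin p') (Fin n') ℝ →ₗ[ℝ] ℝ | ∀ M, |f M| ≤ nuclearNorm M}) hA hconc hC hs hq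
    (hX.measurableSet_spectralNorm_lt κ) (hF.comp_stronglyMeasurable hX.stronglyMeasurable)
    (isBounded_image_spectralNorm_lt hF κ) (fun _ hf => abs_apply_le_of_le_nuclearNorm hf) hL hdec

end RandomMatrix

theorem measureReal_compl_inter_le_exp {Ω : Type*} [MeasurableSpace Ω] {μ : Measure Ω}
    [IsFiniteMeasure μ] {A B : Set Ω} {C₁ C₂ c₁ c₂ θ : ℝ} (hC₁ : 0 ≤ C₁) (hC₂ : 0 ≤ C₂)
    (hc₁ : 0 < c₁) (hc₂ : 0 < c₂) (hθ : 0 ≤ θ) (hA : μ.real Aᶜ ≤ C₁ * Real.exp (-(θ / c₁)))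
    (hB : μ.real Bᶜ ≤ C₂ * Real.exp (-(c₂ * θ))) :
    μ.real (A ∩ B)ᶜ ≤ (C₁ + C₂) * Real.exp (-(θ / max c₁ c₂⁻¹)) := by
  have hθc₁ : θ / max c₁ c₂⁻¹ ≤ θ / c₁ := div_le_div_of_nonneg_left hθ hc₁ (le_max_left _ _)
  have hθc₂ : θ / max c₁ c₂⁻¹ ≤ c₂ * θ := by
    calc θ / max c₁ c₂⁻¹ ≤ θ / c₂⁻¹ :=
          div_le_div_of_nonneg_left hθ (inv_pos.mpr hc₂) (le_max_right _ _)
      _ = c₂ * θ := by rw [div_inv_eq_mul, mul_comm]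
  calc μ.real (A ∩ B)ᶜ ≤ μ.real Aᶜ + μ.real Bᶜ := by
        rw [Set.compl_inter]
        exact measureReal_union_le _ _
    _ ≤ C₁ * Real.exp (-(θ / c₁)) + C₂ * Real.exp (-(c₂ * θ)) := add_le_add hA hB
    _ ≤ C₁ * Real.exp (-(θ / max c₁ c₂⁻¹)) + C₂ * Real.exp (-(θ / max c₁ c₂⁻¹)) := by gcongr
    _ = (C₁ + C₂) * Real.exp (-(θ / max c₁ c₂⁻¹)) := (add_mul _ _ _).symm

section Family

variable {ι : Type*} {Ω : ι → Type*} [∀ k, MeasurableSpace (Ω k)] {μ : ∀ k, Measure (Ω k)}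
  [∀ k, IsProbabilityMeasure (μ k)] {q : ℝ} {σ κ θ : ι → ℝ}

theorem ConvexlyConcentrated.under {E : ι → Type*} [∀ k, AddCommGroup (E k)]
    [∀ k, Module ℝ (E k)] {nrm : ∀ k, E k → ℝ} {Z : ∀ k, Ω k → E k} (θ : ι → ℝ)
    (h : ConvexlyConcentrated μ nrm Z q σ) : ConvexlyConcentratedUnder μ nrm Z q σ θ := by
  refine ⟨fun _ => Set.univ, ⟨fun k => ⟨.univ, by simp⟩, 1, 1, one_pos, one_pos, fun k => ?_⟩, ?_⟩
  · rw [Set.compl_univ, measureReal_empty]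
    positivity
  · simpa only [cond_univ] using h

open scoped Matrix.Norms.Frobenius in
theorem ConvexlyConcentrated.exists_hasConvexTailBounds {ν : ∀ k, Measure (Ω k)} {p n : ι → ℕ}
    {X : ∀ k, Ω k → Matrix (Fin (p k)) (Fin (n k)) ℝ}
    (h : ConvexlyConcentrated ν (fun _ => frobeniusNorm) X q σ) :
    ∃ C c : ℝ, 0 < C ∧ 0 < c ∧ ∀ k, HasConvexTailBounds (ν k) (X k) C (c * σ k) q := by
  obtain ⟨C, c, hC, hc, h⟩ := h
  refine ⟨C, c, hC, hc, fun k f hlip hconv => ⟨_, (h k f (fun x y => ?_) hconv).2⟩⟩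
  simpa only [frobeniusNorm_eq_norm, NNReal.coe_one, one_mul, Real.norm_eq_abs, dist_eq_norm]
    using hlip.dist_le_mul x y

open scoped Matrix.Norms.Frobenius in
theorem linearlyConcentratedUnder_of_isConvexDifferenceOn (hq : 0 < q) (hσ : ∀ k, 0 < σ k)
    (hθ : ∀ k, 0 ≤ θ k) {p n p' n' : ι → ℕ} {X : ∀ k, Ω k → Matrix (Fin (p k)) (Fin (n k)) ℝ}
    (hX : ∀ k, IsRandomMatrix (X k))
    (hconc : ConvexlyConcentratedUnder μ (fun _ => frobeniusNorm) X q σ θ)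
    (hspec : ∃ C c : ℝ, 0 < C ∧ 0 < c ∧ ∀ k,
      (μ k).real {ω | κ k ≤ spectralNorm (X k ω)} ≤ C * Real.exp (-(c * θ k)))
    {F : ∀ k, Matrix (Fin (p k)) (Fin (n k)) ℝ → Matrix (Fin (p' k)) (Fin (n' k)) ℝ}
    (hF : ∀ k, Continuous (F k)) {D : ℝ} (hD : 0 < D) {L : ι → ℝ} (hL : ∀ k, 0 ≤ L k)
    (hdec : ∀ k, ∀ f : Matrix (Fin (p' k)) (Fin (n' k)) ℝ →ₗ[ℝ] ℝ, (∀ M, |f M| ≤ nuclearNorm M) →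
      IsConvexDifferenceOn {M | spectralNorm M < κ k} (D * L k) fun M => f (F k M)) :
    LinearlyConcentratedUnder μ (fun _ => nuclearNorm) (fun k ω => F k (X k ω)) q
      (fun k => L k * σ k) θ := by
  obtain ⟨A, ⟨hA, C₁, c₁, hC₁, hc₁, hAc⟩, hconc⟩ := hconc
  obtain ⟨C₂, c₂, hC₂, hc₂, hspec⟩ := hspec
  obtain ⟨C, c, hC, hc, hconc⟩ := hconc.exists_hasConvexTailBounds
  have hevent := fun k => exists_event_hasTailBound_of_le_nuclearNorm (μ := μ k) (hF k) (hX k)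
    (hA k).1 hC.le (mul_pos hc (hσ k)) hq (mul_nonneg hD.le (hL k)) (hconc k) (hdec k)
  choose G Z hG hGc htail using hevent
  refine ⟨G, ⟨hG, 2 * (C₁ + C₂), max c₁ c₂⁻¹, by positivity, by positivity, fun k => ?_⟩,
    Z, meanTailConst (4 * C) q + Real.exp 1, 4 * D * c, ?_, by positivity, fun k f hf => ?_⟩
  · have hball :
        (μ k).real (X k ⁻¹' {M | spectralNorm M < κ k})ᶜ ≤ C₂ * Real.exp (-(c₂ * θ k)) := by
      convert hspec k using 2
      ext ω
      simp
    rw [mul_assoc]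
    exact (hGc k).trans (mul_le_mul_of_nonneg_left
      (measureReal_compl_inter_le_exp hC₁.le hC₂.le hc₁ hc₂ (hθ k) (hAc k) hball) zero_le_two)
  · unfold meanTailConst
    positivity
  · have hscale : 4 * D * c * (L k * σ k) = 4 * (D * L k * (c * σ k)) := by ring
    rw [hscale]
    exact htail k f hf

theorem linearlyConcentratedUnder_pow (hq : 0 < q) (hσ : ∀ k, 0 < σ k) (hκ : ∀ k, 0 < κ k)
    (hθ : ∀ k, 0 ≤ θ k) {p : ι → ℕ} (m : ι → ℕ)
    {X : ∀ k, Ω k → Matrix (Fin (p k)) (Fin (p k)) ℝ} (hX : ∀ k, IsRandomMatrix (X k))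
    (hconc : ConvexlyConcentratedUnder μ (fun _ => frobeniusNorm) X q σ θ)
    (hspec : ∃ C c : ℝ, 0 < C ∧ 0 < c ∧ ∀ k,
      (μ k).real {ω | κ k ≤ spectralNorm (X k ω)} ≤ C * Real.exp (-(c * θ k))) :
    LinearlyConcentratedUnder μ (fun _ => nuclearNorm) (fun k ω => X k ω ^ m k) q
      (fun k => √(p k) * (2 * Real.exp 1 * κ k) ^ ((m k : ℤ) - 1) * σ k) θ := by
  refine linearlyConcentratedUnder_of_isConvexDifferenceOn (F := fun k M => M ^ m k) hq hσ hθ hX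
    hconc hspec (fun k => by fun_prop) one_pos (fun k => ?_) fun k f hf => ?_
  · have := hκ k
    positivity
  · rw [one_mul]
    exact isConvexDifferenceOn_apply_matrix_pow (hκ k) hf (m k)

theorem linearlyConcentratedUnder_gram_pow (hq : 0 < q) (hσ : ∀ k, 0 < σ k) (hκ : ∀ k, 0 < κ k)
    (hθ : ∀ k, 0 ≤ θ k) {p n : ι → ℕ} (m : ι → ℕ)
    {X : ∀ k, Ω k → Matrix (Fin (p k)) (Fin (n k)) ℝ} (hX : ∀ k, IsRandomMatrix (X k))
    (hconc : ConvexlyConcentratedUnder μ (fun _ => frobeniusNorm) X q σ θ)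
    (hspec : ∃ C c : ℝ, 0 < C ∧ 0 < c ∧ ∀ k,
      (μ k).real {ω | κ k ≤ spectralNorm (X k ω)} ≤ C * Real.exp (-(c * θ k))) :
    LinearlyConcentratedUnder μ (fun _ => nuclearNorm)
      (fun k ω => (X k ω * (X k ω).transpose) ^ m k) q
      (fun k => √((p k : ℝ) + n k) * (2 * Real.exp 1 * κ k) ^ (2 * (m k : ℤ) - 1) * σ k) θ := by
  refine linearlyConcentratedUnder_of_isConvexDifferenceOn
    (F := fun k M => (M * M.transpose) ^ m k) hq hσ hθ hX hconc hspec (fun k => by fun_prop)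
    (Real.sqrt_pos.mpr two_pos) (fun k => ?_) fun k f hf =>
      isConvexDifferenceOn_apply_gram_pow (hκ k) hf (m k)
  have := hκ k
  positivity

theorem linearlyConcentratedUnder_gram_pow_mul (hq : 0 < q) (hσ : ∀ k, 0 < σ k)
    (hκ : ∀ k, 0 < κ k) (hθ : ∀ k, 0 ≤ θ k) {p n : ι → ℕ} (m : ι → ℕ)
    {X : ∀ k, Ω k → Matrix (Fin (p k)) (Fin (n k)) ℝ} (hX : ∀ k, IsRandomMatrix (X k))
    (hconc : ConvexlyConcentratedUnder μ (fun _ => frobeniusNorm) X q σ θ)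
    (hspec : ∃ C c : ℝ, 0 < C ∧ 0 < c ∧ ∀ k,
      (μ k).real {ω | κ k ≤ spectralNorm (X k ω)} ≤ C * Real.exp (-(c * θ k))) :
    LinearlyConcentratedUnder μ (fun _ => nuclearNorm)
      (fun k ω => (X k ω * (X k ω).transpose) ^ m k * X k ω) q
      (fun k => √((p k : ℝ) + n k) * (2 * Real.exp 1 * κ k) ^ (2 * m k) * σ k) θ := by
  refine linearlyConcentratedUnder_of_isConvexDifferenceOn
    (F := fun k M => (M * M.transpose) ^ m k * M) hq hσ hθ hX hconc hspec (fun k => by fun_prop)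
    (Real.sqrt_pos.mpr two_pos) (fun k => ?_) fun k f hf =>
      isConvexDifferenceOn_apply_gram_pow_mul (hκ k) hf (m k)
  have := hκ k
  positivity

end Family

end MatrixConcentration

open MatrixConcentration in
theorem mainTheorem9_general {ι : Type*} {Ω : ι → Type*} [∀ k, MeasurableSpace (Ω k)]
    (μ : ∀ k, Measure (Ω k)) [∀ k, IsProbabilityMeasure (μ k)]
    (q : ℝ) (hq : 0 < q) (p n m : ι → ℕ) (σ κ θ : ι → ℝ)
    (hσ : ∀ k, 0 < σ k) (hκ : ∀ k, 0 < κ k) (hθ : ∀ k, 0 ≤ θ k) :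
    (∀ X : ∀ k, Ω k → Matrix (Fin (p k)) (Fin (p k)) ℝ,
      (∀ k, IsRandomMatrix (X k)) →
      ConvexlyConcentratedUnder μ (fun _ => frobeniusNorm) X q σ θ →
      (∃ C c : ℝ, 0 < C ∧ 0 < c ∧ ∀ k,
        (μ k).real {ω | κ k ≤ spectralNorm (X k ω)} ≤ C * Real.exp (-(c * θ k))) →
      LinearlyConcentratedUnder μ (fun _ => nuclearNorm) (fun k ω => X k ω ^ m k) q
        (fun k => √(p k) * (2 * Real.exp 1 * κ k) ^ ((m k : ℤ) - 1) * σ k) θ) ∧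
    (∀ X : ∀ k, Ω k → Matrix (Fin (p k)) (Fin (n k)) ℝ,
      (∀ k, IsRandomMatrix (X k)) →
      ConvexlyConcentratedUnder μ (fun _ => frobeniusNorm) X q σ θ →
      (∃ C c : ℝ, 0 < C ∧ 0 < c ∧ ∀ k,
        (μ k).real {ω | κ k ≤ spectralNorm (X k ω)} ≤ C * Real.exp (-(c * θ k))) →
      LinearlyConcentratedUnder μ (fun _ => nuclearNorm)
        (fun k ω => (X k ω * (X k ω).transpose) ^ m k) q
        (fun k => √((p k : ℝ) + n k) * (2 * Real.exp 1 * κ k) ^ (2 * (m k : ℤ) - 1) * σ k) θ ∧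
      LinearlyConcentratedUnder μ (fun _ => nuclearNorm)
        (fun k ω => (X k ω * (X k ω).transpose) ^ m k * X k ω) q
        (fun k => √((p k : ℝ) + n k) * (2 * Real.exp 1 * κ k) ^ (2 * m k) * σ k) θ) :=
  ⟨fun _ hX hconc hspec => linearlyConcentratedUnder_pow hq hσ hκ hθ m hX hconc hspec,
    fun _ hX hconc hspec => ⟨linearlyConcentratedUnder_gram_pow hq hσ hκ hθ m hX hconc hspec,
      linearlyConcentratedUnder_gram_pow_mul hq hσ hκ hθ m hX hconc hspec⟩⟩

open MatrixConcentration in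
theorem mainTheorem9 {ι : Type*} {Ω : ι → Type*} [∀ k, MeasurableSpace (Ω k)]
    (μ : ∀ k, Measure (Ω k)) [∀ k, IsProbabilityMeasure (μ k)]
    (q : ℝ) (hq : 0 < q) (p n m : ι → ℕ) (σ κ : ι → ℝ)
    (hσ : ∀ k, 0 < σ k) (hκ : ∀ k, 0 < κ k) :
    (∀ X : ∀ k, Ω k → Matrix (Fin (p k)) (Fin (p k)) ℝ,
      (∀ k, IsRandomMatrix (X k)) →
      (ConvexlyConcentrated μ (fun _ => frobeniusNorm) X q σ ∨
        ConvexlyConcentratedUnder μ (fun _ => frobeniusNorm) X q σ (fun k => (p k : ℝ))) →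
      (∃ C c : ℝ, 0 < C ∧ 0 < c ∧ ∀ k,
        (μ k).real {ω | κ k ≤ spectralNorm (X k ω)} ≤ C * Real.exp (-(c * (p k : ℝ)))) →
      LinearlyConcentratedUnder μ (fun _ => nuclearNorm) (fun k ω => X k ω ^ m k) q
        (fun k => Real.sqrt (p k) * (2 * Real.exp 1 * κ k) ^ ((m k : ℤ) - 1) * σ k)
        (fun k => (p k : ℝ))) ∧
    (∀ X : ∀ k, Ω k → Matrix (Fin (p k)) (Fin (n k)) ℝ,
      (∀ k, IsRandomMatrix (X k)) →
      (ConvexlyConcentrated μ (fun _ => frobeniusNorm) X q σ ∨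
        ConvexlyConcentratedUnder μ (fun _ => frobeniusNorm) X q σ
          (fun k => (p k : ℝ) + (n k : ℝ))) →
      (∃ C c : ℝ, 0 < C ∧ 0 < c ∧ ∀ k,
        (μ k).real {ω | κ k ≤ spectralNorm (X k ω)}
          ≤ C * Real.exp (-(c * ((p k : ℝ) + (n k : ℝ))))) →
      (∀ k i j, Integrable (fun ω => X k ω i j) (μ k)) →
      (∃ K : ℝ, ∀ k,
        spectralNorm (matrixMean (μ k) (X k)) ≤ K * ((p k : ℝ) + (n k : ℝ)) ^ (1 / q)) →
      LinearlyConcentratedUnder μ (fun _ => nuclearNorm)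
        (fun k ω => (X k ω * (X k ω).transpose) ^ m k) q
        (fun k => Real.sqrt ((p k : ℝ) + (n k : ℝ)) *
          (2 * Real.exp 1 * κ k) ^ (2 * (m k : ℤ) - 1) * σ k)
        (fun k => (p k : ℝ) + (n k : ℝ)) ∧
      LinearlyConcentratedUnder μ (fun _ => nuclearNorm)
        (fun k ω => (X k ω * (X k ω).transpose) ^ m k * X k ω) q
        (fun k => Real.sqrt ((p k : ℝ) + (n k : ℝ)) *
          (2 * Real.exp 1 * κ k) ^ (2 * m k) * σ k)
        (fun k => (p k : ℝ) + (n k : ℝ))) := by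
  refine ⟨fun X hX hconc hspec => ?_, fun X hX hconc hspec _ _ => ?_⟩
  · exact (mainTheorem9_general μ q hq p n m σ κ _ hσ hκ fun k => by positivity).1 X hX
      (hconc.elim (·.under _) id) hspec
  · exact (mainTheorem9_general μ q hq p n m σ κ _ hσ hκ fun k => by positivity).2 X hX
      (hconc.elim (·.under _) id) hspec
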